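/- Let $\mathbb{F}_q$ be a finite field with $q$ elements, let $n,m\ge 0$ be integers, and let $\mathcal{C}$ be an $\mathbb{F}_q$-linear subspace of $\mathrm{Mat}(n\times m,\mathbb{F}_q)$ (a Delsarte rank-metric code), with dual code $$\mathcal{C}^{\perp}=\{N\in \mathrm{Mat}(n\times m,\mathbb{F}_q) : \mathrm{Tr}(MN^{T})=0 \text{ for all } M\in\mathcal{C}\}.$$ The rank weight enumerator of $\mathcal{C}$ is $W^{R}_{\mathcal{C}}(x,y)=\sum_{i=0}^{n}A_i(\mathcal{C})\,x^{n-i}y^{i}$, where $A_i(\mathcal{C})=|\{M\in\mathcal{C}:\mathrm{rank}(M)=i\}|$, and likewise for $\mathcal{C}^{\perp}$. Consider homogeneous polynomials in $x,y$ whose coefficients are real functions of an integer variable $m$. The $q$-product of $a(x,y;m)=\sum_{i=0}^{r}a_i(m)x^{r-i}y^{i}$, of degree $r$, and $b(x,y;m)=\sum_{j=0}^{s}b_j(m)x^{s-j}y^{j}$, of degree $s$, is the homogeneous polynomial of degree $r+s$ $$a*b=\sum_{u=0}^{r+s}c_u(m)\,x^{r+s-u}y^{u},\qquad c_u(m)=\sum_{i=0}^{u}q^{is}\,a_i(m)\,b_{u-i}(m-i),$$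 where $a_i=0$ for $i>r$ and $b_j=0$ for $j>s$. The $q$-powers are defined by $a^{[0]}=1$ and $a^{[k]}=a^{[k-1]}*a$ for $k\ge 1$. For $a$ as above and homogeneous linear polynomials $f(x,y;m)$, $g(x,y;m)$, the $q$-transform of $a$ at $(f,g)$ is $$\overline{a}(f,g)=\sum_{i=0}^{r}a_i(m)\;g^{[i]}*f^{[r-i]} .$$ **Theorem (MacWilliams-type identity).** With the coefficients $A_i(\mathcal{C})$ regarded as constant functions of the variable $m$, and with the right-hand side evaluated at $m$ equal to the number of columns of the matrices, $$W^{R}_{\mathcal{C}^{\perp}}(x,y)=\frac{1}{|\mathcal{C}|}\,\overline{W^{R}_{\mathcal{C}}}\bigl(x+(q^{m}-1)y,\;x-y\bigr)$$ as polynomials in $x$ and $y$; that is, $$W^{R}_{\mathcal{C}^{\perp}}(x,y)=\frac{1}{|\mathcal{C}|}\sum_{i=0}^{n}A_i(\mathcal{C})\;(x-y)^{[i]}*\bigl(x+(q^{m}-1)y\bigr)^{[n-i]}.$$ -/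

import Mathlib

noncomputable section

namespace RankMetric

open MvPolynomial

/-! ### Delsarte rank-metric codes

A Delsarte rank-metric code of size `n × m` over a finite field `F` is an `F`-linear subspace
`C : Submodule F (Matrix (Fin n) (Fin m) F)`. -/

/-- The dual code with respect to the trace product `⟨M, N⟩ = Tr (M Nᵀ)`. -/
def dualCode {F : Type*} [Field F] {n m : ℕ} (C : Submodule F (Matrix (Fin n) (Fin m) F)) :
    Submodule F (Matrix (Fin n) (Fin m) F) where
  carrier := {N | ∀ M ∈ C, Matrix.trace (M * N.transpose) = 0}
  add_mem' := by
    intro a b ha hb M hM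
    rw [Matrix.transpose_add, Matrix.mul_add, Matrix.trace_add, ha M hM, hb M hM, add_zero]
  zero_mem' := by
    intro M _
    simp
  smul_mem' := by
    intro c N hN M hM
    rw [Matrix.transpose_smul, Matrix.mul_smul, Matrix.trace_smul, hN M hM, smul_zero]

/-- The number `A_i(C)` of codewords of rank `i`. -/
def rankCount {F : Type*} [Field F] {n m : ℕ} (C : Submodule F (Matrix (Fin n) (Fin m) F))
    (i : ℕ) : ℕ :=
  {M : Matrix (Fin n) (Fin m) F | M ∈ C ∧ M.rank = i}.ncard

/-- The rank weight enumerator `∑_{i=0}^n A_i(C) x^{n-i} y^i`, where `x = X 0`, `y = X 1`, as a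
polynomial over a given coefficient ring `R`. -/
def rankEnumerator (R : Type*) [CommSemiring R] {F : Type*} [Field F] {n m : ℕ}
    (C : Submodule F (Matrix (Fin n) (Fin m) F)) : MvPolynomial (Fin 2) R :=
  ∑ i ∈ Finset.range (n + 1),
    MvPolynomial.C ((rankCount C i : ℕ) : R) * X 0 ^ (n - i) * X 1 ^ i

/-! ### The `q`-product, `q`-powers and the `q`-transform

A homogeneous polynomial `a(x, y; m)` of degree `r` whose coefficients are real functions of the
integer `m` is a homogeneous element of degree `r` of `MvPolynomial (Fin 2) (ℤ → ℝ)`, with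
`x = X 0` and `y = X 1`. The degree is passed explicitly to the operations below. -/

/-- Homogeneous polynomials in `x, y` with coefficients real functions of an integer `m`
live in this ring. -/
abbrev FunPoly : Type := MvPolynomial (Fin 2) (ℤ → ℝ)

/-- The coefficient function `a_i` in `a(x, y; m) = ∑_{i=0}^r a_i(m) x^{r-i} y^i`, understood
to be zero for `i > r`. -/
def coeffFun (r : ℕ) (a : FunPoly) (i : ℕ) : ℤ → ℝ :=
  if i ≤ r then a.coeff (Finsupp.single 0 (r - i) + Finsupp.single 1 i) else 0

/-- The `q`-product `a * b` of homogeneous polynomials of degrees `r` and `s`: the coefficient of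
`x^{r+s-u} y^u` is `c_u(m) = ∑_{i=0}^u q^{is} a_i(m) b_{u-i}(m-i)`. -/
def qProd (q : ℝ) (r s : ℕ) (a b : FunPoly) : FunPoly :=
  ∑ u ∈ Finset.range (r + s + 1),
    C (fun m : ℤ => ∑ i ∈ Finset.range (u + 1),
        q ^ (i * s) * coeffFun r a i m * coeffFun s b (u - i) (m - i))
      * X 0 ^ (r + s - u) * X 1 ^ u

/-- The `k`-th `q`-power `a^{[k]}` of a homogeneous polynomial `a` of degree `r`; it is homogeneous
of degree `k * r`. -/
def qPow (q : ℝ) (r : ℕ) (a : FunPoly) : ℕ → FunPoly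
  | 0 => 1
  | k + 1 => qProd q (k * r) r (qPow q r a k) a

/-- The `q`-transform of a homogeneous polynomial `a(x, y; m) = ∑_{i=0}^r a_i(m) x^{r-i} y^i` of
degree `r`, at linear forms `f` and `g` in place of `x` and `y`:
`∑_{i=0}^r a_i(m) g^{[i]} * f^{[r-i]}`. -/
def qTransform (q : ℝ) (r : ℕ) (a f g : FunPoly) : FunPoly :=
  ∑ i ∈ Finset.range (r + 1),
    C (coeffFun r a i) * qProd q i (r - i) (qPow q 1 g i) (qPow q 1 f (r - i))

/-- The polynomial with real coefficients obtained by fixing the value of `m`. -/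
def specialize (m : ℤ) (a : FunPoly) : MvPolynomial (Fin 2) ℝ :=
  map (Pi.evalRingHom (fun _ : ℤ => ℝ) m) a

/-- The linear form `x + (q^m - 1) y`, its coefficients being functions of `m`. -/
def formPlus (q : ℝ) : FunPoly :=
  X 0 + C (fun m : ℤ => q ^ m - 1) * X 1

/-- The linear form `x - y`. -/
def formMinus : FunPoly :=
  X 0 - X 1

end RankMetric

end

/-! Fix a nontrivial additive character `χ` of the field. Summing χ(Tr(M Nᵀ)) over M in the code and
N of rank u in two orders is Poisson summation: summing over M first detects the dual code, so it
remains to evaluate the sum over N of rank u for a fixed M of rank i.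

The rows of M act as functionals φ_j on V = F^m and the rows of N form a tuple of vectors, so this
inner sum is `tupleSum`. Splitting off the first row gives a recursion in n. If φ_0 = 0, the first
row is only counted, inside or outside the span of the others. If φ_0 ≠ 0, cancellation confines the
other rows to ker φ_0; the dimension and the rank of φ both drop by one.

The coefficients of (x - y)^{[i]} * (x + (q^m - 1)y)^{[n-i]} obey the same two recursions:
`mixedCoeff_succ_right` matches φ_0 = 0, and `mixedCoeff_succ_left`, with its shift m ↦ m - 1,
matches φ_0 ≠ 0. Hence `tupleSum_eq_mixedCoeff`, and `card_mul_rankCount_dualCode` is the identity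
coefficient by coefficient. -/

noncomputable section

namespace RankMetric

open MvPolynomial

/-! ### Coefficients of `q`-products -/

/-- The coefficient sequence of the `q`-product `a * (x + β(m) y)`. -/
def linStep (q : ℝ) (β : ℤ → ℝ) (a : ℕ → ℤ → ℝ) : ℕ → ℤ → ℝ
  | 0, m => a 0 m
  | u + 1, m => q ^ (u + 1) * a (u + 1) m + q ^ u * a u m * β (m - u)

/-- The coefficient sequence of the constant polynomial `1`. -/
def oneCoeff : ℕ → ℤ → ℝ
  | 0, _ => 1
  | _ + 1, _ => 0

/-- The coefficient sequence of `(x + β(m) y)^{[k]}`. -/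
def powCoeff (q : ℝ) (β : ℤ → ℝ) (k : ℕ) : ℕ → ℤ → ℝ :=
  (linStep q β)^[k] oneCoeff

theorem powCoeff_succ (q : ℝ) (β : ℤ → ℝ) (k : ℕ) :
    powCoeff q β (k + 1) = linStep q β (powCoeff q β k) :=
  Function.iterate_succ_apply' _ _ _

theorem powCoeff_eq_zero_of_lt (q : ℝ) (β : ℤ → ℝ) {k u : ℕ} (h : k < u) (m : ℤ) :
    powCoeff q β k u m = 0 := by
  induction k generalizing u with
  | zero => obtain ⟨u, rfl⟩ := Nat.exists_eq_succ_of_ne_zero h.ne'; rfl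
  | succ k ih =>
    obtain ⟨u, rfl⟩ := Nat.exists_eq_succ_of_ne_zero (by lia : u ≠ 0)
    rw [powCoeff_succ]
    simp [linStep, ih (by lia : k < u + 1), ih (by lia : k < u)]

theorem coeff_homogeneousSum {R : Type*} [CommSemiring R] (r : ℕ) (c : ℕ → R) {u : ℕ}
    (hu : u ≤ r) :
    (∑ v ∈ Finset.range (r + 1), C (c v) * (X 0 : MvPolynomial (Fin 2) R) ^ (r - v) *
      X 1 ^ v).coeff (Finsupp.single 0 (r - u) + Finsupp.single 1 u) = c u := by
  have key (v : ℕ) : C (c v) * (X 0 : MvPolynomial (Fin 2) R) ^ (r - v) * X 1 ^ v =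
      monomial (Finsupp.single 0 (r - v) + Finsupp.single 1 v) (c v) := by
    rw [X_pow_eq_monomial, X_pow_eq_monomial, C_mul_monomial, monomial_mul]
    simp
  simp_rw [key, coeff_sum, coeff_monomial]
  rw [Finset.sum_eq_single u]
  · simp
  · intro v _ hv
    rw [if_neg]
    intro h
    have := DFunLike.congr_fun h 1
    simp at this
    exact hv this
  · intro h
    simp at h
    lia

theorem coeffFun_homogeneousSum (r : ℕ) (c : ℕ → ℤ → ℝ) (u : ℕ) :
    coeffFun r (∑ v ∈ Finset.range (r + 1), C (c v) * X 0 ^ (r - v) * X 1 ^ v) u =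
      if u ≤ r then c u else 0 := by
  unfold coeffFun
  split_ifs with h
  · exact coeff_homogeneousSum r c h
  · rfl

theorem coeffFun_linear (β : ℤ → ℝ) (u : ℕ) :
    coeffFun 1 (X 0 + C β * X 1) u = if u = 0 then 1 else if u = 1 then β else 0 := by
  have h := coeffFun_homogeneousSum 1 (fun v => if v = 0 then 1 else β) u
  simp only [Finset.sum_range_succ, Finset.range_zero, Finset.sum_empty, if_true, one_ne_zero,
    if_false, map_one, one_mul, zero_add, Nat.sub_zero, pow_one, pow_zero, mul_one,
    Nat.sub_self] at h
  rw [h]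
  rcases u with _ | _ | u <;> simp

theorem sum_mul_coeffFun_linear (q : ℝ) (β : ℤ → ℝ) (a : ℕ → ℤ → ℝ) (u : ℕ) (m : ℤ) :
    ∑ i ∈ Finset.range (u + 1),
      q ^ (i * 1) * a i m * coeffFun 1 (X 0 + C β * X 1) (u - i) (m - i) = linStep q β a u m := by
  cases u with
  | zero => simp [coeffFun_linear, linStep]
  | succ u =>
    rw [Finset.sum_range_succ, Finset.sum_range_succ, Finset.sum_eq_zero]
    · simp [coeffFun_linear, linStep]
      ring
    · intro i hi
      rw [Finset.mem_range] at hi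
      rw [coeffFun_linear, if_neg (by lia), if_neg (by lia)]
      simp

theorem coeffFun_qPow_linear (q : ℝ) (β : ℤ → ℝ) (k u : ℕ) (m : ℤ) :
    coeffFun k (qPow q 1 (X 0 + C β * X 1) k) u m = powCoeff q β k u m := by
  induction k generalizing u m with
  | zero =>
    rw [qPow]
    have h := coeffFun_homogeneousSum 0 (fun _ => 1) u
    simp at h
    rw [h]
    cases u <;> rfl
  | succ k ih =>
    rw [qPow, qProd, mul_one, coeffFun_homogeneousSum]
    split_ifs with h
    · simp_rw [powCoeff_succ, ih]
      exact sum_mul_coeffFun_linear q β _ u m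
    · exact (powCoeff_eq_zero_of_lt q β (by lia) m).symm

/-- Associativity of the `q`-product when the last factor is linear: the extra weight q^l joins the
q^(u-l) of the inner step to give q^u, and the successive shifts of m add up. -/
theorem sum_mul_linStep (q : ℝ) (β : ℤ → ℝ) (a b : ℕ → ℤ → ℝ) (k u : ℕ) (m : ℤ) :
    ∑ l ∈ Finset.range (u + 1), q ^ (l * (k + 1)) * a l m * linStep q β b (u - l) (m - l) =
      linStep q β (fun u m => ∑ l ∈ Finset.range (u + 1), q ^ (l * k) * a l m * b (u - l) (m - l))
        u m := by
  cases u with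
  | zero => simp [linStep]
  | succ u =>
    rw [linStep, Finset.sum_range_succ, Finset.sum_range_succ (n := u + 1), mul_add (q ^ (u + 1)),
      Finset.mul_sum, Finset.mul_sum, Finset.sum_mul, add_right_comm, ← Finset.sum_add_distrib]
    congr 1
    · refine Finset.sum_congr rfl fun l hl => ?_
      obtain ⟨d, rfl⟩ := Nat.exists_eq_add_of_le (Finset.mem_range_succ_iff.mp hl)
      rw [show l + d + 1 - l = d + 1 by lia, show l + d - l = d by lia, linStep]
      rw [show m - (l : ℤ) - d = m - ((l + d : ℕ) : ℤ) by push_cast; ring]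
      ring
    · simp only [Nat.sub_self, linStep]
      ring

/-- The coefficient sequence of `(x - y)^{[i]} * (x + (q^m - 1) y)^{[k]}`. -/
def mixedCoeff (q : ℝ) (i k : ℕ) : ℕ → ℤ → ℝ :=
  (linStep q fun m => q ^ m - 1)^[k] (powCoeff q (fun _ => -1) i)

theorem mixedCoeff_succ_right (q : ℝ) (i k : ℕ) :
    mixedCoeff q i (k + 1) = linStep q (fun m => q ^ m - 1) (mixedCoeff q i k) :=
  Function.iterate_succ_apply' _ _ _

theorem sum_mul_powCoeff (q : ℝ) (i k u : ℕ) (m : ℤ) :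
    ∑ l ∈ Finset.range (u + 1), q ^ (l * k) * powCoeff q (fun _ => -1) i l m *
      powCoeff q (fun m => q ^ m - 1) k (u - l) (m - l) = mixedCoeff q i k u m := by
  induction k generalizing u m with
  | zero =>
    rw [Finset.sum_range_succ, Finset.sum_eq_zero]
    · simp [powCoeff, oneCoeff, mixedCoeff]
    · intro l hl
      rw [Finset.mem_range] at hl
      rw [powCoeff_eq_zero_of_lt _ (fun m => q ^ m - 1) (by lia : 0 < u - l), mul_zero]
  | succ k ih =>
    rw [powCoeff_succ, sum_mul_linStep, mixedCoeff_succ_right]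
    congr 1
    funext u m
    exact ih u m

theorem powCoeff_neg_one_sub (q : ℝ) (i u : ℕ) (m d : ℤ) :
    powCoeff q (fun _ => -1) i u (m - d) = powCoeff q (fun _ => -1) i u m := by
  induction i generalizing u with
  | zero => cases u <;> rfl
  | succ i ih => rw [powCoeff_succ]; cases u <;> simp [linStep, ih]

/-- For m a dimension, the factor q^m - q^u counts the vectors outside a u-dimensional subspace. -/
theorem linStep_mul_zpow {q : ℝ} (hq : q ≠ 0) (a : ℕ → ℤ → ℝ) (u : ℕ) (m : ℤ) :
    linStep q (fun m => q ^ m - 1) a (u + 1) m =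
      q ^ (u + 1) * a (u + 1) m + (q ^ m - q ^ u) * a u m := by
  rw [linStep, zpow_sub₀ hq, zpow_natCast]
  field_simp

/-- The two linear steps commute once m is shifted by one. For k = 0 the shift is invisible, since
the coefficients of (x - y)^{[i]} do not depend on m. -/
theorem mixedCoeff_succ_left {q : ℝ} (hq : q ≠ 0) (i k u : ℕ) (m : ℤ) :
    mixedCoeff q (i + 1) k u m =
      linStep q (fun _ => -1) (fun u m => mixedCoeff q i k u (m - 1)) u m := by
  induction k generalizing u m with
  | zero =>
    simp only [mixedCoeff, Function.iterate_zero, id, powCoeff_succ]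
    cases u <;> simp [linStep, powCoeff_neg_one_sub]
  | succ k ih =>
    rw [mixedCoeff_succ_right, mixedCoeff_succ_right]
    -- Two steps reach back two indices, so u = 0 and u = 1 are boundary cases.
    rcases u with _ | _ | u
    · simp [linStep, ih]
    · rw [linStep_mul_zpow hq, ih, ih, linStep, linStep, linStep, linStep_mul_zpow hq, linStep,
        zpow_sub₀ hq]
      field_simp
      ring
    · rw [linStep_mul_zpow hq, ih, ih, linStep, linStep, linStep, linStep_mul_zpow hq,
        linStep_mul_zpow hq, zpow_sub₀ hq]
      field_simp
      ring

theorem qProd_qPow_formMinus_formPlus (q : ℝ) (i k : ℕ) :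
    qProd q i k (qPow q 1 formMinus i) (qPow q 1 (formPlus q) k) =
      ∑ u ∈ Finset.range (i + k + 1), C (mixedCoeff q i k u) * X 0 ^ (i + k - u) * X 1 ^ u := by
  have h : formMinus = X 0 + C (fun _ : ℤ => (-1 : ℝ)) * X 1 := by
    rw [show (fun _ : ℤ => (-1 : ℝ)) = -1 from rfl, map_neg, map_one, formMinus]
    ring
  rw [qProd, h, formPlus]
  refine Finset.sum_congr rfl fun u _ => ?_
  congr 3
  funext m
  rw [← sum_mul_powCoeff]
  simp_rw [coeffFun_qPow_linear]

/-! ### Character sums over tuples of given rank -/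

open Module

theorem exists_addChar_ne_zero (F : Type*) [Field F] [Finite F] : ∃ χ : AddChar F ℂ, χ ≠ 0 := by
  obtain ⟨χ, hχ⟩ := AddChar.exists_apply_ne_zero.mpr (one_ne_zero : (1 : F) ≠ 0)
  exact ⟨χ, fun h => hχ (by simp [h])⟩

section

variable {F : Type*} [Field F] {χ : AddChar F ℂ} {V : Type*} [AddCommGroup V] [Module F V]

open Classical in
theorem sum_addChar_linear (hχ : χ ≠ 0) [Fintype V] (f : V →ₗ[F] F) :
    ∑ v, χ (f v) = if f = 0 then (Nat.card V : ℂ) else 0 := by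
  have h := AddChar.sum_eq_ite (χ.compAddMonoidHom f.toAddMonoidHom)
  have h0 : χ.compAddMonoidHom f.toAddMonoidHom = 0 ↔ f = 0 := by
    constructor
    · intro hf
      by_contra hne
      obtain ⟨v, hv⟩ : ∃ v, f v ≠ 0 := by
        by_contra! hall
        exact hne (LinearMap.ext hall)
      refine hχ (DFunLike.ext _ _ fun c => ?_)
      -- A nonzero functional is onto: this multiple of v is sent to c.
      have := DFunLike.congr_fun hf ((c / f v) • v)
      simpa [hv] using this
    · rintro rfl
      ext v
      simp
  simp only [h0] at h
  simpa using h

open Classical in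
theorem sum_addChar_submodule (hχ : χ ≠ 0) [Fintype F] [Fintype V] (f : V →ₗ[F] F)
    (W : Submodule F V) :
    ∑ v, (if v ∈ W then χ (f v) else 0) =
      if W ≤ LinearMap.ker f then (Fintype.card F : ℂ) ^ finrank F W else 0 := by
  have h := sum_addChar_linear hχ (f.domRestrict W)
  rw [← Finset.sum_filter, ← Finset.sum_subtype_eq_sum_filter]
  have h0 : f.domRestrict W = 0 ↔ W ≤ LinearMap.ker f := by
    rw [LinearMap.ext_iff]
    simp [SetLike.le_def]
  rw [Module.natCard_eq_pow_finrank (K := F), Nat.card_eq_fintype_card] at h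
  simp only [h0] at h
  push_cast at h
  rw [← h]
  exact Finset.sum_bij (fun x _ => ⟨x.1, by simp⟩) (by simp) (by simp) (by simp)
    (by simp)

/-- The sum of `χ (∑ j, φ j (v j))` over the tuples `v` whose span has dimension `u`. -/
def tupleSum [Fintype V] (χ : AddChar F ℂ) {n : ℕ} (φ : Fin n → Dual F V) (u : ℕ) : ℂ := by
  classical exact ∑ v : Fin n → V,
    if finrank F (Submodule.span F (Set.range v)) = u then χ (∑ j, φ j (v j)) else 0

open Classical in
theorem finrank_span_range_cons [Finite V] {n : ℕ} (w : V) (v : Fin n → V) :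
    finrank F (Submodule.span F (Set.range (Fin.cons w v : Fin (n + 1) → V))) =
      finrank F (Submodule.span F (Set.range v)) +
        if w ∈ Submodule.span F (Set.range v) then 0 else 1 := by
  rw [Fin.range_cons]
  split_ifs with h
  · rw [Submodule.span_insert_eq_span h, add_zero]
  · rw [Submodule.span_insert, sup_comm, Submodule.finrank_sup_span_singleton h]

open Classical in
/-- Summing over the first entry of a tuple. -/
theorem tupleSum_succ [Fintype F] [Fintype V] (hχ : χ ≠ 0) {n : ℕ} (φ : Fin (n + 1) → Dual F V)
    (u : ℕ) :
    tupleSum χ φ (u + 1) = ∑ v : Fin n → V, χ (∑ j, Fin.tail φ j (v j)) *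
      ((if finrank F (Submodule.span F (Set.range v)) = u + 1 then
          if ∀ j, φ 0 (v j) = 0 then (Fintype.card F : ℂ) ^ (u + 1) else 0 else 0) +
        (if finrank F (Submodule.span F (Set.range v)) = u then
          (if φ 0 = 0 then (Fintype.card F : ℂ) ^ finrank F V else 0) -
            if ∀ j, φ 0 (v j) = 0 then (Fintype.card F : ℂ) ^ u else 0 else 0)) := by
  rw [tupleSum, ← (Fin.consEquiv fun _ => V).sum_comp, Fintype.sum_prod_type_right]
  refine Finset.sum_congr rfl fun v _ => ?_
  have hW := sum_addChar_submodule hχ (φ 0) (Submodule.span F (Set.range v))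
  have hT := sum_addChar_submodule hχ (φ 0) ⊤
  have hle : Submodule.span F (Set.range v) ≤ LinearMap.ker (φ 0) ↔ ∀ j, φ 0 (v j) = 0 := by
    rw [Submodule.span_le, Set.range_subset_iff]
    rfl
  simp only [Submodule.mem_top, if_true, top_le_iff, LinearMap.ker_eq_top, finrank_top] at hT
  rw [hle] at hW
  -- A first entry in the span of the rest keeps the dimension and one outside raises it by one; the
  -- sum over the outside is the sum over V minus the sum over the span.
  have hterm (w : V) : (if finrank F (Submodule.span F (Set.range
        (Fin.consEquiv (fun _ => V) (w, v)))) = u + 1 then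
        χ (∑ j, φ j (Fin.consEquiv (fun _ => V) (w, v) j)) else 0) =
      χ (∑ j, Fin.tail φ j (v j)) *
        ((if finrank F (Submodule.span F (Set.range v)) = u + 1 then
          if w ∈ Submodule.span F (Set.range v) then χ (φ 0 w) else 0 else 0) +
        (if finrank F (Submodule.span F (Set.range v)) = u then
          χ (φ 0 w) - if w ∈ Submodule.span F (Set.range v) then χ (φ 0 w) else 0 else 0)) := by
    have hr := finrank_span_range_cons (F := F) w v
    have hc : (Fin.consEquiv fun _ => V) (w, v) = Fin.cons w v := rfl
    rw [hc, hr, Fin.sum_univ_succ]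
    simp only [Fin.cons_zero, Fin.cons_succ, AddChar.map_add_eq_mul, Fin.tail]
    by_cases hw : w ∈ Submodule.span F (Set.range v)
    · simp [hw, mul_comm]
    · simp [hw, mul_comm]
  rw [Finset.sum_congr rfl fun w _ => hterm w, ← Finset.mul_sum, Finset.sum_add_distrib]
  congr 2
  · split_ifs with h1 <;> simp_all
  · split_ifs with h1 <;> simp_all

theorem tupleSum_zero_right [Fintype V] {n : ℕ} (φ : Fin n → Dual F V) :
    tupleSum χ φ 0 = 1 := by
  classical
  rw [tupleSum, Finset.sum_eq_single 0]
  · simp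
  · intro v _ hv
    rw [if_neg]
    rw [Submodule.finrank_eq_zero, Submodule.span_eq_bot]
    intro h
    exact hv (funext fun j => h _ ⟨j, rfl⟩)
  · simp

theorem tupleSum_succ_of_eq_zero [Fintype F] [Fintype V] (hχ : χ ≠ 0) {n : ℕ}
    (φ : Fin (n + 1) → Dual F V) (h0 : φ 0 = 0) (u : ℕ) :
    tupleSum χ φ (u + 1) = (Fintype.card F : ℂ) ^ (u + 1) * tupleSum χ (Fin.tail φ) (u + 1) +
      ((Fintype.card F : ℂ) ^ finrank F V - (Fintype.card F : ℂ) ^ u) *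
        tupleSum χ (Fin.tail φ) u := by
  classical
  rw [tupleSum_succ hχ, tupleSum, tupleSum, Finset.mul_sum, Finset.mul_sum,
    ← Finset.sum_add_distrib]
  refine Finset.sum_congr rfl fun v _ => ?_
  simp only [h0, LinearMap.zero_apply, implies_true, if_true]
  split_ifs <;> ring

/-- The restrictions of `φ 1, …, φ n` to the kernel of `φ 0`. -/
def restrictKer {n : ℕ} (φ : Fin (n + 1) → Dual F V) :
    Fin n → Dual F (LinearMap.ker (φ 0)) :=
  fun j => (φ j.succ).domRestrict _

theorem tupleSum_restrictKer [Fintype V] {n : ℕ} (φ : Fin (n + 1) → Dual F V)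
    [Fintype (LinearMap.ker (φ 0))] [DecidableEq F] (u : ℕ) :
    tupleSum χ (restrictKer φ) u = ∑ v : Fin n → V, if ∀ j, φ 0 (v j) = 0 then
      if finrank F (Submodule.span F (Set.range v)) = u then χ (∑ j, Fin.tail φ j (v j)) else 0
        else 0 := by
  classical
  rw [tupleSum, ← Finset.sum_filter (p := fun v : Fin n → V => ∀ j, φ 0 (v j) = 0)]
  refine Finset.sum_bij (fun v _ j => (v j : V)) (by simp) ?_ ?_ ?_
  · intro v _ w _ h
    funext j
    exact Subtype.ext (congrFun h j)
  · intro v hv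
    exact ⟨fun j => ⟨v j, by simpa using (Finset.mem_filter.mp hv).2 j⟩, by simp, rfl⟩
  · intro v _
    have : finrank F (Submodule.span F (Set.range fun j => (v j : V))) =
        finrank F (Submodule.span F (Set.range v)) := by
      rw [← Submodule.finrank_map_subtype_eq, Submodule.map_span, ← Set.range_comp]
      rfl
    rw [this]
    rfl

/-- The sum of χ ∘ φ_0 over all of V vanishes, and over the span of the remaining entries it
survives only if they all lie in ker φ_0. -/
theorem tupleSum_succ_of_ne_zero [Fintype F] [Fintype V] (hχ : χ ≠ 0) {n : ℕ}
    (φ : Fin (n + 1) → Dual F V) [Fintype (LinearMap.ker (φ 0))] (h0 : φ 0 ≠ 0) (u : ℕ) :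
    tupleSum χ φ (u + 1) = (Fintype.card F : ℂ) ^ (u + 1) * tupleSum χ (restrictKer φ) (u + 1) -
      (Fintype.card F : ℂ) ^ u * tupleSum χ (restrictKer φ) u := by
  classical
  rw [tupleSum_succ hχ, tupleSum_restrictKer, tupleSum_restrictKer, Finset.mul_sum,
    Finset.mul_sum, ← Finset.sum_sub_distrib]
  refine Finset.sum_congr rfl fun v _ => ?_
  simp only [h0, if_false]
  split_ifs <;> ring

theorem finrank_map_add_one {U U' : Type*} [AddCommGroup U] [Module F U] [FiniteDimensional F U]
    [AddCommGroup U'] [Module F U'] (g : U →ₗ[F] U') {x : U} (hx : x ≠ 0)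
    (hg : LinearMap.ker g = Submodule.span F {x}) {W : Submodule F U} (hxW : x ∈ W) :
    finrank F (W.map g) + 1 = finrank F W := by
  have h := (g.domRestrict W).finrank_range_add_finrank_ker
  have hker : LinearMap.ker (g.domRestrict W) = Submodule.span F {(⟨x, hxW⟩ : W)} := by
    ext y
    rw [LinearMap.mem_ker, LinearMap.domRestrict_apply, ← LinearMap.mem_ker, hg,
      Submodule.mem_span_singleton, Submodule.mem_span_singleton]
    simp [Subtype.ext_iff]
  rwa [LinearMap.range_domRestrict, hker,
    finrank_span_singleton fun h => hx (congrArg Subtype.val h)] at h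

/-- A functional vanishing on ker f is a multiple of f. -/
theorem ker_dualRestrict_ker (f : Dual F V) :
    LinearMap.ker (LinearMap.ker f).dualRestrict = Submodule.span F {f} := by
  ext ψ
  rw [LinearMap.mem_ker]
  constructor
  · intro h
    have hle : ⨅ _ : Unit, LinearMap.ker f ≤ LinearMap.ker ψ := by
      rw [iInf_const]
      intro v hv
      exact DFunLike.congr_fun h ⟨v, hv⟩
    simpa using mem_span_of_iInf_ker_le_ker (L := fun _ : Unit => f) hle
  · rw [Submodule.mem_span_singleton]
    rintro ⟨c, rfl⟩
    ext v
    have hv : f v = 0 := v.2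
    simp [hv]

/-- Restriction to ker φ_0 kills exactly the line through φ_0, which lies in the span of φ. -/
theorem finrank_span_restrictKer [Finite V] {n : ℕ} (φ : Fin (n + 1) → Dual F V)
    (h0 : φ 0 ≠ 0) :
    finrank F (Submodule.span F (Set.range (restrictKer φ))) + 1 =
      finrank F (Submodule.span F (Set.range φ)) := by
  have hg : (LinearMap.ker (φ 0)).dualRestrict ∘ φ = Fin.cons 0 (restrictKer φ) := by
    funext j
    refine Fin.cases ?_ (fun j => rfl) j
    ext v
    exact v.2
  rw [← finrank_map_add_one _ h0 (ker_dualRestrict_ker (φ 0))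
    (Submodule.subset_span (Set.mem_range_self 0)), Submodule.map_span, ← Set.range_comp, hg,
    Fin.range_cons, Submodule.span_insert_zero]

end

theorem mixedCoeff_zero_zero (q : ℝ) (u : ℕ) (m : ℤ) :
    mixedCoeff q 0 0 u m = if u = 0 then 1 else 0 := by
  cases u <;> rfl

theorem mixedCoeff_zero_right (q : ℝ) (i k : ℕ) (m : ℤ) : mixedCoeff q i k 0 m = 1 := by
  induction k with
  | zero =>
    rw [mixedCoeff, Function.iterate_zero, id]
    induction i with
    | zero => rfl
    | succ i ih => rw [powCoeff_succ, linStep, ih]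
  | succ k ih => rw [mixedCoeff_succ_right, linStep, ih]

/-- The character sum over the tuples of rank `u` depends only on the rank of `φ`. -/
theorem tupleSum_eq_mixedCoeff {F : Type*} [Field F] [Fintype F] {χ : AddChar F ℂ} (hχ : χ ≠ 0)
    {V : Type*} [AddCommGroup V] [Module F V] [Fintype V] {n : ℕ} (φ : Fin n → Dual F V)
    {i k : ℕ} (hi : finrank F (Submodule.span F (Set.range φ)) = i) (hk : i + k = n) (u : ℕ) :
    tupleSum χ φ u = (mixedCoeff (Fintype.card F) i k u (finrank F V) : ℝ) := by
  classical
  have hq : (Fintype.card F : ℝ) ≠ 0 := by simp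
  -- V must vary, because the case φ_0 ≠ 0 replaces it by a hyperplane.
  induction n generalizing V i k u with
  | zero =>
    obtain ⟨rfl, rfl⟩ : i = 0 ∧ k = 0 := by lia
    rw [mixedCoeff_zero_zero, tupleSum, Fintype.sum_unique, Set.range_eq_empty,
      Submodule.span_empty, finrank_bot]
    cases u <;> simp
  | succ n ih =>
    cases u with
    | zero => rw [tupleSum_zero_right, mixedCoeff_zero_right, Complex.ofReal_one]
    | succ u =>
      by_cases h0 : φ 0 = 0
      · have hspan : finrank F (Submodule.span F (Set.range (Fin.tail φ))) = i := by
          rw [← hi]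
          conv_rhs => rw [← Fin.cons_self_tail φ, Fin.range_cons, h0, Submodule.span_insert_zero]
        have hle : finrank F (Submodule.span F (Set.range (Fin.tail φ))) ≤ n :=
          (finrank_range_le_card (R := F) (Fin.tail φ)).trans_eq (Fintype.card_fin n)
        -- The n remaining functionals already have rank i, so i ≤ n and k ≥ 1.
        obtain ⟨k, rfl⟩ := Nat.exists_eq_succ_of_ne_zero (by lia : k ≠ 0)
        rw [tupleSum_succ_of_eq_zero hχ φ h0, ih (k := k) _ hspan (by lia),
          ih (k := k) _ hspan (by lia),
          mixedCoeff_succ_right, linStep_mul_zpow hq, zpow_natCast]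
        push_cast
        rfl
      · have := Fintype.ofFinite (LinearMap.ker (φ 0))
        have hspan := finrank_span_restrictKer φ h0
        obtain ⟨i, rfl⟩ := Nat.exists_eq_succ_of_ne_zero (by lia : i ≠ 0)
        -- The kernel has dimension one less than V, which is the shift m - 1 in
        -- `mixedCoeff_succ_left`.
        have hdim := Dual.finrank_ker_add_one_of_ne_zero h0
        rw [tupleSum_succ_of_ne_zero hχ φ h0, ih (i := i) (k := k) _ (by lia) (by lia),
          ih (i := i) (k := k) _ (by lia) (by lia), mixedCoeff_succ_left hq, linStep, ← hdim]
        push_cast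
        rw [add_sub_cancel_right]
        ring

/-! ### Poisson summation over a code -/

section

variable {F : Type*} [Field F] {n m : ℕ}

/-- `Tr (M Nᵀ)` as a sum of functionals applied to the rows of `N`. -/
theorem trace_mul_transpose_eq_sum (M N : Matrix (Fin n) (Fin m) F) :
    Matrix.trace (M * N.transpose) = ∑ j, dotProductEquiv F (Fin m) (M j) (N j) := by
  simp [Matrix.trace, Matrix.mul_apply, dotProduct]

theorem finrank_span_dotProductEquiv (M : Matrix (Fin n) (Fin m) F) :
    finrank F (Submodule.span F (Set.range fun j => dotProductEquiv F (Fin m) (M j))) =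
      M.rank := by
  rw [Matrix.rank_eq_finrank_span_row,
    ← LinearEquiv.finrank_map_eq (dotProductEquiv F (Fin m)) (Submodule.span F (Set.range M.row)),
    Submodule.map_span, ← Set.range_comp]
  rfl

theorem sum_addChar_trace [Fintype F] {χ : AddChar F ℂ} (hχ : χ ≠ 0)
    (M : Matrix (Fin n) (Fin m) F) (u : ℕ) :
    ∑ N : Matrix (Fin n) (Fin m) F with N.rank = u, χ (Matrix.trace (M * N.transpose)) =
      (mixedCoeff (Fintype.card F) M.rank (n - M.rank) u m : ℝ) := by
  classical
  have h := tupleSum_eq_mixedCoeff hχ (fun j => dotProductEquiv F (Fin m) (M j))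
    (finrank_span_dotProductEquiv M) (Nat.add_sub_cancel' (M.rank_le_height)) u
  rw [finrank_fin_fun] at h
  rw [← h, tupleSum, Finset.sum_filter]
  refine Finset.sum_congr rfl fun N _ => ?_
  rw [Matrix.rank_eq_finrank_span_row, trace_mul_transpose_eq_sum]
  rfl

open Classical in
theorem sum_codewords_addChar_trace [Fintype F] {χ : AddChar F ℂ} (hχ : χ ≠ 0)
    (C : Submodule F (Matrix (Fin n) (Fin m) F)) (N : Matrix (Fin n) (Fin m) F) :
    ∑ M : C, χ (Matrix.trace (M.1 * N.transpose)) =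
      if N ∈ dualCode C then (Nat.card C : ℂ) else 0 := by
  have h := sum_addChar_linear hχ
    ((Matrix.traceLinearMap (Fin n) F F ∘ₗ mulRightLinearMap (Fin n) F N.transpose) ∘ₗ C.subtype)
  have h0 : (Matrix.traceLinearMap (Fin n) F F ∘ₗ mulRightLinearMap (Fin n) F N.transpose) ∘ₗ
      C.subtype = 0 ↔ N ∈ dualCode C := by
    rw [LinearMap.ext_iff, Subtype.forall]
    rfl
  simp only [h0] at h
  exact h

theorem rankCount_eq_card [Fintype F] (C : Submodule F (Matrix (Fin n) (Fin m) F)) (i : ℕ)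
    [DecidablePred (· ∈ C)] :
    rankCount C i = (Finset.univ.filter fun M : Matrix (Fin n) (Fin m) F =>
      M ∈ C ∧ M.rank = i).card := by
  classical
  rw [rankCount, ← Set.ncard_coe_finset]
  simp

/-- The MacWilliams identity for the rank distribution. -/
theorem card_mul_rankCount_dualCode [Fintype F] (C : Submodule F (Matrix (Fin n) (Fin m) F))
    (u : ℕ) :
    (Nat.card C : ℝ) * rankCount (dualCode C) u = ∑ i ∈ Finset.range (n + 1),
      (rankCount C i : ℝ) * mixedCoeff (Fintype.card F) i (n - i) u m := by
  classical
  obtain ⟨χ, hχ⟩ := exists_addChar_ne_zero F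
  apply Complex.ofReal_injective
  calc ((Nat.card C * rankCount (dualCode C) u : ℝ) : ℂ)
      = ∑ N : Matrix (Fin n) (Fin m) F with N.rank = u,
          ∑ M : C, χ (Matrix.trace (M.1 * N.transpose)) := by
        simp_rw [sum_codewords_addChar_trace hχ]
        rw [← Finset.sum_filter, Finset.filter_filter, Finset.sum_const, rankCount_eq_card]
        simp [and_comm, mul_comm]
    _ = ∑ M : C, ((mixedCoeff (Fintype.card F) M.1.rank (n - M.1.rank) u m : ℝ) : ℂ) := by
        rw [Finset.sum_comm]
        exact Finset.sum_congr rfl fun M _ => sum_addChar_trace hχ M.1 u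
    _ = _ := by
        -- The summand depends on M only through its rank, so codewords are grouped by rank.
        rw [← Finset.sum_fiberwise_of_maps_to (t := Finset.range (n + 1))
          (g := fun M : C => M.1.rank)
          (fun M _ => Finset.mem_range_succ_iff.mpr M.1.rank_le_height), Complex.ofReal_sum]
        refine Finset.sum_congr rfl fun i _ => ?_
        rw [Finset.sum_congr rfl (g := fun _ =>
          ((mixedCoeff (Fintype.card F) i (n - i) u m : ℝ) : ℂ))
          fun M hM => by rw [(Finset.mem_filter.mp hM).2], Finset.sum_const, rankCount_eq_card]
        rw [nsmul_eq_mul, Complex.ofReal_mul, Complex.ofReal_natCast]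
        congr 2
        exact Finset.card_bij (fun M _ => M.1) (by simp) (by simp) (by simp +contextual)

end

/-! ### Evaluation at the number of columns and the polynomial identity -/

theorem specialize_homogeneousSum (m : ℤ) (r : ℕ) (c : ℕ → ℤ → ℝ) :
    specialize m (∑ u ∈ Finset.range (r + 1), C (c u) * X 0 ^ (r - u) * X 1 ^ u) =
      ∑ u ∈ Finset.range (r + 1), C (c u m) * X 0 ^ (r - u) * X 1 ^ u := by
  simp [specialize]

end RankMetric

end

theorem mainTheorem2 {F : Type*} [Field F] [Fintype F] (n m : ℕ)
    (C : Submodule F (Matrix (Fin n) (Fin m) F)) :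
    RankMetric.rankEnumerator ℝ (RankMetric.dualCode C) =
      MvPolynomial.C (1 / (Nat.card C : ℝ)) *
        RankMetric.specialize (m : ℤ)
          (RankMetric.qTransform (Fintype.card F : ℝ) n
            (RankMetric.rankEnumerator (ℤ → ℝ) C)
            (RankMetric.formPlus (Fintype.card F : ℝ)) RankMetric.formMinus) := by
  open RankMetric MvPolynomial in
  have hcard : (Nat.card C : ℝ) ≠ 0 := by
    exact_mod_cast Nat.card_pos.ne'
  have htrans : qTransform (Fintype.card F : ℝ) n (rankEnumerator (ℤ → ℝ) C)
      (formPlus (Fintype.card F : ℝ)) formMinus =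
      ∑ u ∈ Finset.range (n + 1), MvPolynomial.C (∑ i ∈ Finset.range (n + 1),
        ((rankCount C i : ℕ) : ℤ → ℝ) * mixedCoeff (Fintype.card F) i (n - i) u) *
          X 0 ^ (n - u) * X 1 ^ u := by
    simp_rw [map_sum, Finset.sum_mul]
    rw [Finset.sum_comm, qTransform]
    refine Finset.sum_congr rfl fun i hi => ?_
    have hin := Finset.mem_range_succ_iff.mp hi
    rw [rankEnumerator, coeffFun_homogeneousSum n (fun i => ((rankCount C i : ℕ) : ℤ → ℝ)),
      if_pos hin, qProd_qPow_formMinus_formPlus, Nat.add_sub_cancel' hin, Finset.mul_sum]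
    refine Finset.sum_congr rfl fun u _ => ?_
    rw [C_mul]
    ring
  rw [htrans, specialize_homogeneousSum, rankEnumerator, Finset.mul_sum]
  refine Finset.sum_congr rfl fun u _ => ?_
  rw [← mul_assoc, ← mul_assoc, ← C_mul]
  congr 3
  rw [Finset.sum_apply]
  have h := card_mul_rankCount_dualCode C u
  simp only [Pi.mul_apply, Pi.natCast_apply]
  rw [← h]
  field_simp
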